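/- Call two nonzero complex numbers $\alpha,\beta$ multiplicatively independent if $\alpha^p=\beta^q$ with $p,q\in\mathbb Z$ holds only for $p=q=0$, and multiplicatively dependent otherwise. For $k\ge 3$ let $\zeta_k\in\mathbb C$ be a primitive $k$-th root of unity, and let $\Phi_k$ be the $k$-th cyclotomic polynomial. For each integer $a>0$ there are only finitely many pairs $(m,k)\in\mathbb Z^+\times\mathbb Z_{\ge 3}$ such that $-m+\zeta_k$ and $-(m+a)+\zeta_k$ are multiplicatively dependent. Moreover, these pairs are effectively computable: there is an algorithm, independent of the choice of the roots of unity $\zeta_k$, which on input $a>0$ outputs the finite list of exactly these pairs. In addition, for every such pair $(m,k)\neq(1,6)$ the following bounds hold. Let $S$ be the set of primes dividing $\Phi_k(m)\Phi_k(m+a)$. Then $S$ is non-empty, and every $p\in S$ satisfies $p\mid a$, $p\nmid k$ and $k\le p^{\nu_p(a)}$, where $\nu_p$ is the $p$-adic valuation; in particular $k\le a$. Moreover, if $f_p$ denotes the multiplicative order of $p$ modulo $k$, then $$\Phi_k(x)\ \Big|\ \prod_{p\in S}p^{\lfloor \nu_p(a)/f_p\rfloor f_p}$$ for $x=m$ or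 $x=m+a$. -/

import Mathlib

/-- Two numbers `α`, `β` are multiplicatively independent if `α ^ p = β ^ q` has only the
trivial solution `p = q = 0` over the integers. -/
def MultIndependent (α β : ℂ) : Prop :=
  ∀ p q : ℤ, α ^ p = β ^ q → p = 0 ∧ q = 0

/-- Multiplicative dependence: `α ^ p = β ^ q` for some integers `p`, `q`, not both zero. -/
def MultDependent (α β : ℂ) : Prop :=
  ¬ MultIndependent α β

/-- The pairs `(m, k)` with `m ≥ 1` and `k ≥ 3` such that `-m + ζ_k` and `-(m + a) + ζ_k` are
multiplicatively dependent, for a choice `ζ` of roots of unity `ζ k = ζ_k`. -/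
def dependentPairs (ζ : ℕ → ℂ) (a : ℕ) : Set (ℕ × ℕ) :=
  {x | 1 ≤ x.1 ∧ 3 ≤ x.2 ∧
    MultDependent (-(x.1 : ℂ) + ζ x.2) (-((x.1 : ℂ) + (a : ℂ)) + ζ x.2)}

/-- The value `Φ_k(x)` of the `k`-th cyclotomic polynomial at a natural number `x`. -/
noncomputable def cyclotomicValue (k x : ℕ) : ℤ :=
  (Polynomial.cyclotomic k ℤ).eval (x : ℤ)

/-- The set of primes dividing `Φ_k(m) * Φ_k(m + a)`. -/
noncomputable def cyclotomicPrimes (a m k : ℕ) : Finset ℕ :=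
  (cyclotomicValue k m * cyclotomicValue k (m + a)).natAbs.primeFactors

/-- The product of `p ^ (⌊ν_p(a) / f_p⌋ * f_p)` over the primes `p` dividing
`Φ_k(m) * Φ_k(m + a)`, where `f_p` is the order of `p` modulo `k`. -/
noncomputable def boundingInteger (a m k : ℕ) : ℕ :=
  ∏ p ∈ cyclotomicPrimes a m k,
    p ^ (padicValNat p a / orderOf (p : ZMod k) * orderOf (p : ZMod k))

open Polynomial

/-! Write `n = m + a`, `α = ζ - m`, `β = ζ - n`, and let `A = Φ_k(m)`, `B = Φ_k(n)` be their norms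
from `ℚ(ζ)`. Dependence yields `α ^ r = β ^ s` with `r ≥ 1`, since `B > 1`. Outside `(1, 6)`,
comparing absolute values forces `1 ≤ s < r`. Then `(β / α) ^ s = α ^ (r - s)` is integral, so `α`
divides `β` in `ℤ[ζ]`, which gives `A ∣ a` (`dvd_of_pow_eq_pow`). As `A ^ r = B ^ s`, each prime `p
∈ S` divides both norms. If `p ∣ k`, it would divide each exactly once, forcing `r = s`; hence `p ∤
k`, so `p ≡ 1` mod `k` and `f_p = 1`. The bounds follow. For the algorithm, these bounds confine `m`
and `k`, `exists_bounded_pow_eq` confines the exponents, and `relationTest_iff` decides a single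
relation by a congruence between natural numbers. Everything is primitive recursive and free of `ζ`.
-/

/-! ### Cyclotomic values as norms -/

theorem cyclotomic_dvd_iff_aeval_eq_zero {K : Type*} [Field K] [CharZero K] {k : ℕ} (hk : 0 < k)
    {μ : K} (hμ : IsPrimitiveRoot μ k) (F : ℤ[X]) :
    cyclotomic k ℤ ∣ F ↔ aeval μ F = 0 := by
  rw [cyclotomic_eq_minpoly hμ hk]
  exact (minpoly.isIntegrallyClosed_dvd_iff (hμ.isIntegral hk) F).symm

theorem cyclotomicValue_eq_prod {k : ℕ} (hk : 0 < k) (x : ℕ) :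
    (cyclotomicValue k x : ℂ) = ∏ μ ∈ primitiveRoots k ℂ, ((x : ℂ) - μ) := by
  have h := cyclotomic_eq_prod_X_sub_primitiveRoots (Complex.isPrimitiveRoot_exp k hk.ne')
  have h2 := cyclotomic.eval_apply (x : ℤ) k (Int.castRingHom ℂ)
  simp only [eq_intCast, Int.cast_natCast] at h2
  rw [cyclotomicValue, ← h2, h, eval_prod]
  simp

theorem cyclotomicValue_pos {k : ℕ} (hk : 3 ≤ k) (x : ℕ) : 0 < cyclotomicValue k x :=
  cyclotomic_pos (by omega) _

theorem natAbs_cyclotomicValue_eq_prod {k : ℕ} (hk : 0 < k) (x : ℕ) :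
    ((cyclotomicValue k x).natAbs : ℝ) = ∏ μ ∈ primitiveRoots k ℂ, ‖-(x : ℂ) + μ‖ := by
  have h := congrArg norm (cyclotomicValue_eq_prod hk x)
  rw [norm_prod] at h
  rw [Nat.cast_natAbs, Int.cast_abs, ← Complex.norm_intCast, h]
  refine Finset.prod_congr rfl fun μ _ => ?_
  rw [← norm_neg]
  ring_nf

theorem natAbs_cyclotomicValue_le {k : ℕ} (hk : 0 < k) (x : ℕ) :
    (cyclotomicValue k x).natAbs ≤ (x + 1) ^ k := by
  have h : ((cyclotomicValue k x).natAbs : ℝ) ≤ (x + 1) ^ k := by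
    rw [natAbs_cyclotomicValue_eq_prod hk]
    calc ∏ μ ∈ primitiveRoots k ℂ, ‖-(x : ℂ) + μ‖
        ≤ ∏ _μ ∈ primitiveRoots k ℂ, ((x : ℝ) + 1) := by
          refine Finset.prod_le_prod (fun _ _ => norm_nonneg _) fun μ hμ => ?_
          refine (norm_add_le _ _).trans ?_
          rw [norm_neg, Complex.norm_natCast,
            (isPrimitiveRoot_of_mem_primitiveRoots hμ).norm'_eq_one hk.ne']
      _ = ((x : ℝ) + 1) ^ k.totient := by
          rw [Finset.prod_const, Complex.card_primitiveRoots]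
      _ ≤ _ := pow_le_pow_right₀ (by linarith [x.cast_nonneg (α := ℝ)]) (Nat.totient_le k)
  exact_mod_cast h

theorem lt_natAbs_cyclotomicValue {k x : ℕ} (hk : 3 ≤ k) (hx : 2 ≤ x) :
    x - 1 < (cyclotomicValue k x).natAbs :=
  sub_one_lt_natAbs_cyclotomic_eval (by omega) (by omega)

/-- A monomial relation between `-m + ζ` and `-n + ζ` descends to their norms. -/
theorem natAbs_cyclotomicValue_relation {k : ℕ} (hk : 0 < k) {ζ : ℂ} (hζ : IsPrimitiveRoot ζ k)
    (m n r s t u : ℕ)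
    (h : (-(m : ℂ) + ζ) ^ r * (-(n : ℂ) + ζ) ^ s = (-(m : ℂ) + ζ) ^ t * (-(n : ℂ) + ζ) ^ u) :
    (cyclotomicValue k m).natAbs ^ r * (cyclotomicValue k n).natAbs ^ s =
      (cyclotomicValue k m).natAbs ^ t * (cyclotomicValue k n).natAbs ^ u := by
  have hd : cyclotomic k ℤ ∣ (-(m : ℤ[X]) + X) ^ r * (-(n : ℤ[X]) + X) ^ s -
      (-(m : ℤ[X]) + X) ^ t * (-(n : ℤ[X]) + X) ^ u := by
    rw [cyclotomic_dvd_iff_aeval_eq_zero hk hζ]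
    simp [h]
  have hR : (((cyclotomicValue k m).natAbs : ℝ) ^ r * ((cyclotomicValue k n).natAbs : ℝ) ^ s =
      ((cyclotomicValue k m).natAbs : ℝ) ^ t * ((cyclotomicValue k n).natAbs : ℝ) ^ u) := by
    simp only [natAbs_cyclotomicValue_eq_prod hk, ← Finset.prod_pow, ← Finset.prod_mul_distrib]
    refine Finset.prod_congr rfl fun μ hμ => ?_
    have hμ' := (cyclotomic_dvd_iff_aeval_eq_zero hk
      (isPrimitiveRoot_of_mem_primitiveRoots hμ) _).1 hd
    simp only [map_sub, map_mul, map_pow, map_add, map_neg, map_natCast, aeval_X, sub_eq_zero]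
      at hμ'
    simpa using congrArg norm hμ'
  exact_mod_cast hR

/-! ### Absolute values of `ζ - x` -/

theorem re_lt_one {k : ℕ} (hk : 3 ≤ k) {ζ : ℂ} (hζ : IsPrimitiveRoot ζ k) : ζ.re < 1 := by
  have h1 : ‖ζ‖ = 1 := hζ.norm'_eq_one (by omega)
  have h2 : ζ.re * ζ.re + ζ.im * ζ.im = 1 := by
    rw [← Complex.normSq_apply, Complex.normSq_eq_norm_sq, h1, one_pow]
  refine lt_of_le_of_ne (h1 ▸ Complex.re_le_norm ζ) fun h => ?_
  have h3 : ζ.im = 0 := by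
    rw [h] at h2
    simpa using h2
  exact hζ.ne_one (by omega) (Complex.ext (by simpa using h) (by simpa using h3))

theorem norm_sq_neg_natCast_add {k : ℕ} (hk : k ≠ 0) {ζ : ℂ} (hζ : IsPrimitiveRoot ζ k) (x : ℕ) :
    ‖-(x : ℂ) + ζ‖ ^ 2 = x ^ 2 - 2 * x * ζ.re + 1 := by
  have h2 : ζ.re * ζ.re + ζ.im * ζ.im = 1 := by
    rw [← Complex.normSq_apply, Complex.normSq_eq_norm_sq, hζ.norm'_eq_one hk, one_pow]
  rw [← Complex.normSq_eq_norm_sq, Complex.normSq_apply]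
  simp only [Complex.add_re, Complex.neg_re, Complex.natCast_re, Complex.add_im, Complex.neg_im,
    Complex.natCast_im]
  linear_combination h2

theorem norm_neg_natCast_add_lt {k : ℕ} (hk : 3 ≤ k) {ζ : ℂ} (hζ : IsPrimitiveRoot ζ k) {m n : ℕ}
    (hm : 1 ≤ m) (hmn : m < n) : ‖-(m : ℂ) + ζ‖ < ‖-(n : ℂ) + ζ‖ := by
  refine lt_of_pow_lt_pow_left₀ 2 (norm_nonneg _) ?_
  rw [norm_sq_neg_natCast_add (by omega) hζ, norm_sq_neg_natCast_add (by omega) hζ]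
  have h1 := re_lt_one hk hζ
  have h2 : (1 : ℝ) ≤ m := by exact_mod_cast hm
  have h3 : (m : ℝ) < n := by exact_mod_cast hmn
  nlinarith [mul_pos (sub_pos.2 h3) (show (0 : ℝ) < n + m - 2 * ζ.re by linarith)]

theorem one_lt_norm_neg_natCast_add {k : ℕ} (hk : 3 ≤ k) {ζ : ℂ} (hζ : IsPrimitiveRoot ζ k) {n : ℕ}
    (hn : 2 ≤ n) : 1 < ‖-(n : ℂ) + ζ‖ := by
  refine lt_of_pow_lt_pow_left₀ 2 (norm_nonneg _) ?_
  rw [norm_sq_neg_natCast_add (by omega) hζ]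
  have h1 := re_lt_one hk hζ
  have h2 : (2 : ℝ) ≤ n := by exact_mod_cast hn
  nlinarith [mul_pos (show (0 : ℝ) < n by linarith) (show (0 : ℝ) < n - 2 * ζ.re by linarith)]

theorem eq_one_and_eq_six_of_norm_eq_one {k : ℕ} (hk : 3 ≤ k) {ζ : ℂ} (hζ : IsPrimitiveRoot ζ k)
    {m : ℕ} (hm : 1 ≤ m) (h : ‖-(m : ℂ) + ζ‖ = 1) : m = 1 ∧ k = 6 := by
  have hm1 : m = 1 := by
    by_contra hne
    exact (one_lt_norm_neg_natCast_add hk hζ (n := m) (by omega)).ne' h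
  subst hm1
  refine ⟨rfl, ?_⟩
  have h1 := norm_sq_neg_natCast_add (by omega) hζ 1
  rw [h] at h1
  have hre : ζ.re = 1 / 2 := by
    push_cast at h1
    linarith
  have h2 : ζ.re * ζ.re + ζ.im * ζ.im = 1 := by
    rw [← Complex.normSq_apply, Complex.normSq_eq_norm_sq, hζ.norm'_eq_one (by omega), one_pow]
  have hq : ζ ^ 2 - ζ + 1 = 0 := by
    rw [hre] at h2
    apply Complex.ext <;> simp [pow_two, hre] <;> linarith
  have h3 : ζ ^ 3 = -1 := by linear_combination (ζ + 1) * hq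
  have h6 : k ∣ 6 := (hζ.pow_eq_one_iff_dvd 6).1 (by linear_combination (ζ ^ 3 - 1) * h3)
  have hle : k ≤ 6 := Nat.le_of_dvd (by norm_num) h6
  interval_cases k
  · have := hζ.pow_eq_one
    rw [h3] at this
    norm_num at this
  · omega
  · omega
  · rfl

/-! ### Relations with natural exponents -/

theorem multDependent_of_pow_eq {α β : ℂ} {r s : ℕ} (hr : 1 ≤ r) (h : α ^ r = β ^ s) :
    MultDependent α β := fun hi => by
  have := (hi r s (by simpa using h)).1
  omega

/-- Taking norms excludes the other sign patterns: `A ^ r * B ^ s = 1` with `B > 1` forces `s = 0`,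
and so does `1 = B ^ s`. -/
theorem exists_pow_eq_of_multDependent {k : ℕ} (hk : 3 ≤ k) {ζ : ℂ} (hζ : IsPrimitiveRoot ζ k)
    {m n : ℕ} (hn : 2 ≤ n) (h : MultDependent (-(m : ℂ) + ζ) (-(n : ℂ) + ζ)) :
    ∃ r s : ℕ, 1 ≤ r ∧ (-(m : ℂ) + ζ) ^ r = (-(n : ℂ) + ζ) ^ s := by
  have hB : 1 < (cyclotomicValue k n).natAbs := by
    have := lt_natAbs_cyclotomicValue hk hn
    omega
  have hβ : -(n : ℂ) + ζ ≠ 0 :=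
    norm_pos_iff.1 (zero_lt_one.trans (one_lt_norm_neg_natCast_add hk hζ hn))
  have key1 : ∀ r s : ℕ, ¬ (r = 0 ∧ s = 0) → (-(m : ℂ) + ζ) ^ r = (-(n : ℂ) + ζ) ^ s →
      ∃ r s : ℕ, 1 ≤ r ∧ (-(m : ℂ) + ζ) ^ r = (-(n : ℂ) + ζ) ^ s := by
    intro r s hrs he
    rcases Nat.eq_zero_or_pos r with rfl | hr
    · have := natAbs_cyclotomicValue_relation (by omega) hζ m n 0 0 0 s (by simpa using he)
      have hs : s = 0 := by
        by_contra hs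
        have := Nat.one_lt_pow hs hB
        simp_all
      exact absurd ⟨rfl, hs⟩ hrs
    · exact ⟨r, s, hr, he⟩
  have key2 : ∀ r s : ℕ, ¬ (r = 0 ∧ s = 0) → (-(m : ℂ) + ζ) ^ r * (-(n : ℂ) + ζ) ^ s = 1 →
      ∃ r s : ℕ, 1 ≤ r ∧ (-(m : ℂ) + ζ) ^ r = (-(n : ℂ) + ζ) ^ s := by
    intro r s hrs he
    have h1 := natAbs_cyclotomicValue_relation (by omega) hζ m n r s 0 0 (by simpa using he)
    simp only [pow_zero, mul_one] at h1
    have hs : s = 0 := by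
      by_contra hs
      exact (Nat.one_lt_pow hs hB).ne' (Nat.eq_one_of_mul_eq_one_left h1)
    subst hs
    exact ⟨r, 0, by omega, by simpa using he⟩
  simp only [MultDependent, MultIndependent, not_forall] at h
  obtain ⟨p, q, he, hpq⟩ := h
  obtain ⟨r, rfl | rfl⟩ := p.eq_nat_or_neg <;> obtain ⟨s, rfl | rfl⟩ := q.eq_nat_or_neg
  · exact key1 r s (by simpa using hpq) (by simpa using he)
  · refine key2 r s (by simpa using hpq) ?_
    simp only [zpow_neg, zpow_natCast] at he
    rw [he, inv_mul_cancel₀ (pow_ne_zero _ hβ)]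
  · refine key2 r s (by simpa using hpq) ?_
    simp only [zpow_neg, zpow_natCast] at he
    have hne : (-(m : ℂ) + ζ) ^ r ≠ 0 := fun h0 => pow_ne_zero s hβ (by rw [← he, h0, inv_zero])
    rw [← he, mul_inv_cancel₀ hne]
  · exact key1 r s (by simpa using hpq) (by simpa using he)

/-- The relation `(ζ - m) ^ r = (ζ - n) ^ s` does not depend on the field or on the primitive
root of unity. -/
theorem pow_eq_pow_iff {K L : Type*} [Field K] [CharZero K] [Field L] [CharZero L] {k : ℕ}
    (hk : 0 < k) {ζ : K} (hζ : IsPrimitiveRoot ζ k) {ξ : L} (hξ : IsPrimitiveRoot ξ k)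
    (m n r s : ℕ) :
    (-(m : K) + ζ) ^ r = (-(n : K) + ζ) ^ s ↔ (-(m : L) + ξ) ^ r = (-(n : L) + ξ) ^ s := by
  have h1 := cyclotomic_dvd_iff_aeval_eq_zero hk hζ
    ((-(m : ℤ[X]) + X) ^ r - (-(n : ℤ[X]) + X) ^ s)
  have h2 := cyclotomic_dvd_iff_aeval_eq_zero hk hξ
    ((-(m : ℤ[X]) + X) ^ r - (-(n : ℤ[X]) + X) ^ s)
  simp only [map_sub, map_pow, map_add, map_neg, map_natCast, aeval_X, sub_eq_zero] at h1 h2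
  rw [← h1, h2]

theorem neg_natCast_add_ne_zero {K : Type*} [Field K] [CharZero K] {k : ℕ} (hk : 3 ≤ k) {ζ : K}
    (hζ : IsPrimitiveRoot ζ k) (x : ℕ) : -(x : K) + ζ ≠ 0 := by
  intro h0
  have hx : ζ = (x : K) := by linear_combination h0
  have h1 := hζ.pow_eq_one
  rw [hx] at h1 hζ
  have h2 : x = 1 := (Nat.pow_eq_one.1 (by exact_mod_cast h1)).resolve_right (by omega)
  exact hζ.ne_one (by omega) (by rw [h2, Nat.cast_one])

/-- Reconciles the `ℚ`-algebra structure built into `CyclotomicField` with the canonical one of a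
field of characteristic zero. -/
theorem isCyclotomicExtension_cyclotomicField_rat (k : ℕ) :
    IsCyclotomicExtension {k} ℚ (CyclotomicField k ℚ) := by
  rw [Subsingleton.elim DivisionRing.toRatAlgebra (CyclotomicField.algebra k ℚ)]
  infer_instance

/-! ### Divisibility of `a` by `Φ_k(m)` -/

/-- The quotient `β / α` is integral because its `s`-th power is `α ^ (r - s)`. As `ℤ[ζ]` is the
full ring of integers, the quotient is `g(ζ)` for an integer polynomial `g`. -/
theorem dvd_of_pow_eq_pow {K : Type*} [Field K] [NumberField K] {k : ℕ} (hk : 3 ≤ k)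
    [IsCyclotomicExtension {k} ℚ K] {z : K} (hz : IsPrimitiveRoot z k)
    {m a r s : ℕ} (hs : 1 ≤ s) (hsr : s ≤ r)
    (h : (-(m : K) + z) ^ r = (-((m + a : ℕ) : K) + z) ^ s) :
    cyclotomicValue k m ∣ (a : ℤ) := by
  have : NeZero k := ⟨by omega⟩
  have hα : -(m : K) + z ≠ 0 := neg_natCast_add_ne_zero hk hz m
  have hint : IsIntegral ℤ ((-((m + a : ℕ) : K) + z) / (-(m : K) + z)) := by
    refine IsIntegral.of_pow (n := s) hs ?_
    rw [div_pow, ← h, div_eq_mul_inv, ← pow_sub₀ _ hα hsr]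
    have hm : IsIntegral ℤ (m : K) := by
      simpa using isIntegral_algebraMap (R := ℤ) (A := K) (x := (m : ℤ))
    exact (hm.neg.add (hz.isIntegral (by omega))).pow _
  obtain ⟨y, hy⟩ :=
    (IsCyclotomicExtension.Rat.isIntegralClosure_adjoin_singleton hz).isIntegral_iff.1 hint
  obtain ⟨g, hg⟩ : (y : K) ∈ (aeval (R := ℤ) z).range :=
    Algebra.adjoin_singleton_eq_range_aeval ℤ z ▸ y.2
  have hy' : aeval z g = (-((m + a : ℕ) : K) + z) / (-(m : K) + z) := by
    rw [← hy]; exact hg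
  have hd : cyclotomic k ℤ ∣ (X - (m : ℤ[X])) * g - (X - ((m + a : ℕ) : ℤ[X])) := by
    rw [cyclotomic_dvd_iff_aeval_eq_zero (by omega) hz]
    simp only [map_sub, map_mul, aeval_X, map_natCast, hy']
    field_simp
    ring
  -- At `X = m` the multiple of `g` vanishes and `a` remains.
  have := eval_dvd (x := (m : ℤ)) hd
  simpa [cyclotomicValue] using this

/-! ### Prime divisors of cyclotomic values -/

/-- For a proper divisor `n` of `k`, `Φ_k` divides `(X ^ k - 1) / (X ^ n - 1)`. -/
theorem cyclotomicValue_dvd_geom_sum {k n p : ℕ} (hk : 0 < k) (hp : 1 < p) (hkn : k = n * p)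
    (x : ℕ) : cyclotomicValue k x ∣ ∑ i ∈ Finset.range p, ((x : ℤ) ^ n) ^ i := by
  have hn : n ∈ k.properDivisors := by
    rw [Nat.mem_properDivisors]
    refine ⟨⟨p, hkn⟩, ?_⟩
    rcases Nat.eq_zero_or_pos n with rfl | hn
    · simpa using hk
    · nlinarith
  have hn0 : n ≠ 0 := by
    rintro rfl
    omega
  have h := X_pow_sub_one_mul_cyclotomic_dvd_X_pow_sub_one_of_dvd ℤ hn
  have h2 : ((X : ℤ[X]) ^ k - 1) =
      (X ^ n - 1) * ∑ i ∈ Finset.range p, ((X : ℤ[X]) ^ n) ^ i := by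
    rw [mul_geom_sum, ← pow_mul, ← hkn]
  have h3 : ((X : ℤ[X]) ^ n - 1) ≠ 0 := (monic_X_pow_sub_C (1 : ℤ) hn0).ne_zero
  rw [h2] at h
  have := eval_dvd (x := (x : ℤ)) ((mul_dvd_mul_iff_left h3).1 h)
  simpa [cyclotomicValue, eval_finsetSum] using this

theorem cyclotomicValue_dvd_pow_sub_one (k x : ℕ) :
    cyclotomicValue k x ∣ (x : ℤ) ^ k - 1 := by
  simpa [cyclotomicValue] using eval_dvd (x := (x : ℤ)) (cyclotomic.dvd_X_pow_sub_one k ℤ)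

/-- A prime dividing both `k ≥ 3` and `Φ_k(x)` divides `Φ_k(x)` exactly once. -/
theorem not_sq_dvd_cyclotomicValue {k p x : ℕ} (hk : 3 ≤ k) (hp : p.Prime) (hpk : p ∣ k)
    (hpx : (p : ℤ) ∣ cyclotomicValue k x) : ¬ (p : ℤ) ^ 2 ∣ cyclotomicValue k x := by
  have hcases : ∀ y : ZMod 2, y = 0 ∨ y = 1 := by decide
  intro hsq
  have := Fact.mk hp
  obtain ⟨n, hn⟩ := hpk
  have hn' : k = n * p := by rw [hn, mul_comm]
  have hsum := hsq.trans (cyclotomicValue_dvd_geom_sum (by omega) hp.one_lt hn' x)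
  rcases hp.eq_two_or_odd' with rfl | hodd
  -- For `p = 2` and `n` even, `4` would divide `1 + y ^ 2`. For `n` odd, `Φ_k(x)` divides the sum
  -- of `n` powers of `x ^ 2`, which is odd.
  · rw [Finset.sum_range_succ, Finset.sum_range_one, pow_zero, pow_one] at hsum
    rcases Nat.even_or_odd n with ⟨t, ht⟩ | hnodd
    · rw [ht, ← two_mul, mul_comm, pow_mul] at hsum
      generalize (x : ℤ) ^ t = y at *
      have h4 : ∀ z : ZMod 4, 1 + z ^ 2 ≠ 0 := by decide
      refine h4 y ?_
      have := (ZMod.intCast_zmod_eq_zero_iff_dvd (1 + y ^ 2) 4).2 (by simpa using hsum)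
      simpa using this
    · have h2 := hpx.trans
        (cyclotomicValue_dvd_geom_sum (k := k) (n := 2) (p := n) (by omega) (by omega) hn x)
      have h3 : ((∑ i ∈ Finset.range n, ((x : ℤ) ^ 2) ^ i : ℤ) : ZMod 2) = 0 :=
        (ZMod.intCast_zmod_eq_zero_iff_dvd _ 2).2 (by simpa using h2)
      have hn0 : n ≠ 0 := by omega
      push_cast at h3
      rcases hcases (x : ZMod 2) with h | h
      · rw [h] at h3
        simp [zero_pow_eq, Finset.sum_ite_eq', hn0] at h3
      · rw [h] at h3
        simp only [one_pow, Finset.sum_const, Finset.card_range, nsmul_eq_mul, mul_one] at h3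
        exact (Nat.not_even_iff_odd.2 hnodd) ((ZMod.natCast_eq_zero_iff_even).1 h3)
  -- By Fermat, `x ^ n ≡ x ^ k ≡ 1` mod `p`. For odd `p` the geometric sum is then `≡ p` mod `p ^
  -- 2`.
  · have h1 : (p : ℤ) ∣ (x : ℤ) ^ n - 1 := by
      have h2 := hpx.trans (cyclotomicValue_dvd_pow_sub_one k x)
      rw [hn', pow_mul] at h2
      rw [← ZMod.intCast_zmod_eq_zero_iff_dvd] at h2 ⊢
      push_cast at h2 ⊢
      rwa [ZMod.pow_card] at h2
    obtain ⟨t, ht⟩ := h1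
    have h3 := odd_sq_dvd_geom_sum₂_sub (1 : ℤ) t hodd
    rw [show (1 : ℤ) + p * t = (x : ℤ) ^ n by linear_combination -ht] at h3
    simp only [one_pow, mul_one] at h3
    have h4 := (Int.dvd_iff_dvd_of_dvd_sub h3).1 hsum
    rw [pow_two] at h4
    have h5 : (p : ℤ) * p ∣ p * 1 := by simpa using h4
    have h6 := (mul_dvd_mul_iff_left (by exact_mod_cast hp.ne_zero)).1 h5
    exact hp.one_lt.ne' (by exact_mod_cast Int.eq_one_of_dvd_one (by positivity) h6)

/-- Modulo `p`, `x` is a primitive `k`-th root of unity, so its order `k` divides `p - 1`. -/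
theorem dvd_sub_one_of_dvd_cyclotomicValue {k p x : ℕ} (hk : 0 < k) (hp : p.Prime) (hpk : ¬ p ∣ k)
    (hpx : (p : ℤ) ∣ cyclotomicValue k x) : k ∣ p - 1 := by
  have := Fact.mk hp
  have : NeZero (k : ZMod p) := ⟨fun h => hpk ((ZMod.natCast_eq_zero_iff k p).1 h)⟩
  have hroot : (cyclotomic k (ZMod p)).IsRoot (x : ZMod p) := by
    have h1 : ((cyclotomicValue k x : ℤ) : ZMod p) = 0 :=
      (ZMod.intCast_zmod_eq_zero_iff_dvd _ p).2 hpx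
    have h2 := cyclotomic.eval_apply (x : ℤ) k (Int.castRingHom (ZMod p))
    simp only [eq_intCast, Int.cast_natCast] at h2
    rw [IsRoot, h2]
    exact h1
  have hprim := isRoot_cyclotomic_iff.1 hroot
  have hx0 : (x : ZMod p) ≠ 0 := hprim.ne_zero hk.ne'
  rw [hprim.eq_orderOf]
  exact ZMod.orderOf_dvd_card_sub_one hx0

/-! ### Bounds for dependent pairs -/

theorem dependent_bounds {k : ℕ} (hk : 3 ≤ k) {ζ : ℂ} (hζ : IsPrimitiveRoot ζ k)
    {m a : ℕ} (hm : 1 ≤ m) (ha : 0 < a) (hne : ¬ (m = 1 ∧ k = 6))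
    (h : MultDependent (-(m : ℂ) + ζ) (-((m + a : ℕ) : ℂ) + ζ)) :
    (cyclotomicValue k m ∣ (a : ℤ)) ∧ (cyclotomicPrimes a m k).Nonempty ∧
      ∀ p ∈ cyclotomicPrimes a m k, p ∣ a ∧ ¬ p ∣ k ∧ k ∣ p - 1 := by
  obtain ⟨r, s, hr, he⟩ := exists_pow_eq_of_multDependent hk hζ (n := m + a) (by omega) h
  have hβ := one_lt_norm_neg_natCast_add hk hζ (n := m + a) (by omega)
  have hαβ := norm_neg_natCast_add_lt hk hζ hm (n := m + a) (by omega)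
  have hnorm := congrArg norm he
  rw [norm_pow, norm_pow] at hnorm
  have hs : 1 ≤ s := by
    by_contra hs
    obtain rfl : s = 0 := by omega
    rw [pow_zero, pow_eq_one_iff_of_nonneg (norm_nonneg _) (by omega)] at hnorm
    exact hne (eq_one_and_eq_six_of_norm_eq_one hk hζ hm hnorm)
  -- If `r ≤ s`, then `|β| ^ s > 1` forces `|α| > 1`, whence `|α| ^ r ≤ |α| ^ s < |β| ^ s`.
  have hsr : s < r := by
    by_contra! hrs
    have hα : 1 < ‖-(m : ℂ) + ζ‖ := by
      by_contra! hα
      have h1 := pow_le_one₀ (n := r) (norm_nonneg _) hα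
      have h2 := one_lt_pow₀ hβ (n := s) (by omega)
      linarith
    have h1 := pow_le_pow_right₀ hα.le hrs
    have h2 := pow_lt_pow_left₀ hαβ (norm_nonneg _) (n := s) (by omega)
    linarith
  have : NeZero k := ⟨by omega⟩
  have := isCyclotomicExtension_cyclotomicField_rat k
  have hz := IsCyclotomicExtension.zeta_spec k ℚ (CyclotomicField k ℚ)
  have hAa := dvd_of_pow_eq_pow hk hz hs hsr.le ((pow_eq_pow_iff (by omega) hζ hz _ _ _ _).1 he)
  have hrel := natAbs_cyclotomicValue_relation (by omega) hζ m (m + a) r 0 0 s (by simpa using he)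
  simp only [pow_zero, mul_one, one_mul] at hrel
  have hB := lt_natAbs_cyclotomicValue hk (x := m + a) (by omega)
  have hprod : (cyclotomicValue k m * cyclotomicValue k (m + a)).natAbs ≠ 1 := by
    rw [Int.natAbs_mul]
    intro h1
    have := Nat.eq_one_of_mul_eq_one_left h1
    omega
  refine ⟨hAa, ?_, ?_⟩
  · obtain ⟨p, hp, hpd⟩ := Nat.exists_prime_and_dvd hprod
    refine ⟨p, Nat.mem_primeFactors.2 ⟨hp, hpd, ?_⟩⟩
    exact Int.natAbs_ne_zero.2
      (mul_pos (cyclotomicValue_pos hk _) (cyclotomicValue_pos hk _)).ne'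
  · intro p hp
    obtain ⟨hp, hpd, -⟩ := Nat.mem_primeFactors.1 hp
    have := Fact.mk hp
    rw [Int.natAbs_mul] at hpd
    have hpA : p ∣ (cyclotomicValue k m).natAbs := by
      rcases hp.dvd_mul.1 hpd with h | h
      · exact h
      · exact hp.dvd_of_dvd_pow (hrel ▸ dvd_pow h (by omega))
    have hpB : p ∣ (cyclotomicValue k (m + a)).natAbs :=
      hp.dvd_of_dvd_pow (n := s) (hrel ▸ dvd_pow hpA (by omega))
    have hpA' : (p : ℤ) ∣ cyclotomicValue k m := Int.natCast_dvd.2 hpA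
    have hpB' : (p : ℤ) ∣ cyclotomicValue k (m + a) := Int.natCast_dvd.2 hpB
    -- Otherwise both norms have `p`-adic valuation `1`, and `A ^ r = B ^ s` gives `r = s`.
    have hpk : ¬ p ∣ k := by
      intro hpk
      have val : ∀ x : ℕ, (p : ℤ) ∣ cyclotomicValue k x →
          padicValNat p (cyclotomicValue k x).natAbs = 1 := by
        intro x hx
        have h1 := not_sq_dvd_cyclotomicValue hk hp hpk hx
        have h0 : (cyclotomicValue k x).natAbs ≠ 0 :=
          Int.natAbs_ne_zero.2 (cyclotomicValue_pos hk x).ne'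
        have h2 : ¬ 2 ≤ padicValNat p (cyclotomicValue k x).natAbs := fun h2 =>
          h1 (by exact_mod_cast Int.natCast_dvd.2 ((padicValNat_dvd_iff_le h0).2 h2))
        have h3 := one_le_padicValNat_of_dvd h0 (Int.natCast_dvd.1 hx)
        omega
      have := congrArg (padicValNat p) hrel
      have h0 : ∀ x, (cyclotomicValue k x).natAbs ≠ 0 := fun x =>
        Int.natAbs_ne_zero.2 (cyclotomicValue_pos hk x).ne'
      rw [padicValNat.pow, padicValNat.pow, val _ hpA', val _ hpB'] at this
      omega
    exact ⟨by exact_mod_cast hpA'.trans hAa, hpk,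
      dvd_sub_one_of_dvd_cyclotomicValue (by omega) hp hpk hpA'⟩

/-- Since `p ≡ 1` mod `k`, every `f_p` is `1`, so the bounding integer is the part of `a` supported
on `S`. -/
theorem dvd_boundingInteger {k m a : ℕ} (hk : 3 ≤ k) (ha : 0 < a)
    (hA : cyclotomicValue k m ∣ (a : ℤ))
    (hS : ∀ p ∈ cyclotomicPrimes a m k, p ∣ a ∧ ¬ p ∣ k ∧ k ∣ p - 1) :
    cyclotomicValue k m ∣ (boundingInteger a m k : ℤ) := by
  have hbound : boundingInteger a m k = ∏ p ∈ cyclotomicPrimes a m k, p ^ a.factorization p := by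
    refine Finset.prod_congr rfl fun p hp => ?_
    have hpp := Nat.prime_of_mem_primeFactors hp
    have h1 : (p : ZMod k) = 1 := by
      obtain ⟨t, ht⟩ := (hS p hp).2.2
      have : p = k * t + 1 := by have := hpp.one_lt; omega
      rw [this]
      simp
    rw [h1, orderOf_one, Nat.div_one, mul_one, Nat.factorization_def _ hpp]
  rw [← Int.natAbs_dvd, Int.natCast_dvd_natCast, hbound]
  have h0 : ∀ x, (cyclotomicValue k x).natAbs ≠ 0 := fun x =>
    Int.natAbs_ne_zero.2 (cyclotomicValue_pos hk x).ne'
  have hA' : (cyclotomicValue k m).natAbs ∣ a := by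
    rwa [← Int.natAbs_dvd, Int.natCast_dvd_natCast] at hA
  calc (cyclotomicValue k m).natAbs
      = ∏ p ∈ (cyclotomicValue k m).natAbs.primeFactors,
          p ^ (cyclotomicValue k m).natAbs.factorization p :=
        (Nat.prod_factorization_pow_eq_self (h0 m)).symm
    _ ∣ ∏ p ∈ (cyclotomicValue k m).natAbs.primeFactors, p ^ a.factorization p :=
        Finset.prod_dvd_prod_of_dvd _ _ fun p _ =>
          pow_dvd_pow p ((Nat.factorization_le_iff_dvd (h0 m) ha.ne').2 hA' p)
    _ ∣ _ := by
        refine Finset.prod_dvd_prod_of_subset _ _ _ (Nat.primeFactors_mono ?_ ?_)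
        · rw [Int.natAbs_mul]
          exact dvd_mul_right _ _
        · rw [Int.natAbs_mul]
          exact mul_ne_zero (h0 _) (h0 _)

/-- Generically `k ≤ p - 1 < a` and `m ≤ Φ_k(m) ≤ a`; the margin `7` also covers `(1, 6)`. -/
theorem dependentPairs_bounds {ζ : ℕ → ℂ} (hζ : ∀ k, 3 ≤ k → IsPrimitiveRoot (ζ k) k) {a : ℕ}
    (ha : 0 < a) {m k : ℕ} (hmk : (m, k) ∈ dependentPairs ζ a) : m < a + 7 ∧ k < a + 7 := by
  obtain ⟨hm, hk, hd⟩ := hmk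
  simp only at hm hk hd
  by_cases hne : m = 1 ∧ k = 6
  · omega
  obtain ⟨hA, ⟨p, hp⟩, hS⟩ := dependent_bounds hk (hζ k hk) hm ha hne (by exact_mod_cast hd)
  have hpp := Nat.prime_of_mem_primeFactors hp
  obtain ⟨hpa, -, hkp⟩ := hS p hp
  have h1 := Nat.le_of_dvd ha hpa
  have h2 := Nat.le_of_dvd (by have := hpp.one_lt; omega) hkp
  refine ⟨?_, by omega⟩
  by_contra hlt
  have h3 := lt_natAbs_cyclotomicValue hk (x := m) (by omega)
  rw [← Int.natAbs_dvd, Int.natCast_dvd_natCast] at hA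
  have h4 := Nat.le_of_dvd ha hA
  omega

/-! ### Bounding the exponents -/

theorem pow_two_mul_eq_one_of_pow_eq_one {K : Type*} [Field K] [NumberField K] {k : ℕ} [NeZero k]
    [IsCyclotomicExtension {k} ℚ K] {x : K} {n : ℕ} (hn : n ≠ 0) (hx : x ^ n = 1) :
    x ^ (2 * k) = 1 := by
  have h0 : orderOf x ≠ 0 :=
    (orderOf_pos_iff.2 (isOfFinOrder_iff_pow_eq_one.2 ⟨n, Nat.pos_of_ne_zero hn, hx⟩)).ne'
  exact orderOf_dvd_iff_pow_eq_one.1 ((IsPrimitiveRoot.orderOf x).dvd_of_isCyclotomicExtension k h0)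

/-- A bound for the exponents of a multiplicative relation. -/
def exponentBound (n k : ℕ) : ℕ := 2 * k * (n + 1) ^ k

theorem padicValNat_le_self (p n : ℕ) [Fact p.Prime] : padicValNat p n ≤ n := by
  rcases Nat.eq_zero_or_pos n with rfl | hn
  · simp
  · exact (Nat.lt_pow_self (Fact.out : p.Prime).one_lt).le.trans
      (Nat.le_of_dvd hn pow_padicValNat_dvd)

/-- Take a prime `p ∣ B` and set `e = v_p(A)`, `f = v_p(B)`. From `r * e = s * f`, `α ^ f / β ^ e`
is a root of unity in `ℚ(ζ)`, of order dividing `2 * k`. Hence `2 * k * f` and `2 * k * e` are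
admissible exponents, bounded through `A, B ≤ (n + 1) ^ k`. -/
theorem exists_bounded_pow_eq {k : ℕ} (hk : 3 ≤ k) {ζ : ℂ} (hζ : IsPrimitiveRoot ζ k)
    {m n : ℕ} (hmn : m ≤ n) (hn : 2 ≤ n) (h : MultDependent (-(m : ℂ) + ζ) (-(n : ℂ) + ζ)) :
    ∃ r s : ℕ, 1 ≤ r ∧ r ≤ exponentBound n k ∧ s ≤ exponentBound n k ∧
      (-(m : ℂ) + ζ) ^ r = (-(n : ℂ) + ζ) ^ s := by
  obtain ⟨r, s, hr, he⟩ := exists_pow_eq_of_multDependent hk hζ hn h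
  have : NeZero k := ⟨by omega⟩
  have := isCyclotomicExtension_cyclotomicField_rat k
  have hz := IsCyclotomicExtension.zeta_spec k ℚ (CyclotomicField k ℚ)
  have hrel := natAbs_cyclotomicValue_relation (by omega) hζ m n r 0 0 s (by simpa using he)
  simp only [pow_zero, mul_one, one_mul] at hrel
  rw [pow_eq_pow_iff (by omega) hζ hz] at he
  simp only [pow_eq_pow_iff (show 0 < k by omega) hζ hz]
  generalize IsCyclotomicExtension.zeta k ℚ (CyclotomicField k ℚ) = z at he hz ⊢
  rcases Nat.eq_zero_or_pos s with rfl | hs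
  · refine ⟨2 * k, 0, by omega, ?_, by omega, ?_⟩
    · exact Nat.le_mul_of_pos_right _ (by positivity)
    · rw [pow_zero] at he ⊢
      exact pow_two_mul_eq_one_of_pow_eq_one (k := k) (by omega) he
  have hB := lt_natAbs_cyclotomicValue hk hn
  have hleA := (natAbs_cyclotomicValue_le (show 0 < k by omega) m).trans
    (Nat.pow_le_pow_left (show m + 1 ≤ n + 1 by omega) k)
  have hleB := natAbs_cyclotomicValue_le (show 0 < k by omega) n
  obtain ⟨p, hp, hpB⟩ :=
    Nat.exists_prime_and_dvd (show (cyclotomicValue k n).natAbs ≠ 1 by omega)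
  have := Fact.mk hp
  have hf := one_le_padicValNat_of_dvd (show (cyclotomicValue k n).natAbs ≠ 0 by omega) hpB
  have hlef := padicValNat_le_self p (cyclotomicValue k n).natAbs
  have hlee := padicValNat_le_self p (cyclotomicValue k m).natAbs
  have hval := congrArg (padicValNat p) hrel
  rw [padicValNat.pow, padicValNat.pow] at hval
  set f := padicValNat p (cyclotomicValue k n).natAbs
  set e := padicValNat p (cyclotomicValue k m).natAbs
  have hβ := neg_natCast_add_ne_zero hk hz n
  have hone : ((-(m : CyclotomicField k ℚ) + z) ^ f / (-(n : CyclotomicField k ℚ) + z) ^ e) ^ s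
      = 1 := by
    rw [div_pow, ← pow_mul, ← pow_mul, mul_comm f s, ← hval, pow_mul, he, ← pow_mul, mul_comm s e,
      div_self (pow_ne_zero _ hβ)]
  have h2 := pow_two_mul_eq_one_of_pow_eq_one (k := k) hs.ne' hone
  rw [div_pow, div_eq_one_iff_eq (pow_ne_zero _ (pow_ne_zero _ hβ)), ← pow_mul, ← pow_mul] at h2
  refine ⟨f * (2 * k), e * (2 * k), ?_, ?_, ?_, h2⟩
  · exact Nat.mul_pos hf (by omega)
  · rw [exponentBound, mul_comm]
    exact Nat.mul_le_mul_left _ (hlef.trans hleB)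
  · rw [exponentBound, mul_comm]
    exact Nat.mul_le_mul_left _ (hlee.trans hleA)

/-! ### Deciding a relation by one integer congruence -/

/-- A polynomial that is small on the unit circle and whose value at a large integer `N` is
divisible by `N ^ k - 1` vanishes at the primitive `k`-th roots of unity. -/
theorem aeval_eq_zero_of_dvd_eval {K : Type*} [Field K] [NumberField K] {k : ℕ} (hk : 0 < k)
    {z : K} (hz : IsPrimitiveRoot z k) {H : ℤ[X]} {N L : ℝ} {M : ℤ} (hM : (M : ℝ) = N)
    (hH : ∀ η : ℂ, ‖η‖ = 1 → ‖aeval η H‖ ≤ L) (hL : L + 1 < N)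
    (hdvd : M ^ k - 1 ∣ H.eval M) : aeval z H = 0 := by
  obtain ⟨t, ht⟩ := hdvd
  have hroot : (H - C t * (X ^ k - 1)).IsRoot M := by
    simp [ht, mul_comm]
  obtain ⟨q, hq⟩ := dvd_iff_isRoot.2 hroot
  have hmul : ∀ {F : Type _} [Field F] (w : F), w ^ k = 1 →
      aeval w H = (w - (M : F)) * aeval w q := by
    intro F _ w hw
    have := congrArg (aeval w) hq
    simpa [hw] using this
  have hzH := hmul z hz.pow_eq_one
  -- Every conjugate of the algebraic integer `q(z)` has absolute value at most `L / (N - 1) < 1`.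
  -- By Kronecker, a nonzero one would be a root of unity, of absolute value `1`.
  have hγ : aeval z q = 0 := by
    by_contra h0
    have hint : IsIntegral ℤ (aeval z q) := by
      have := (hz.isIntegral hk)
      exact IsIntegral.of_mem_of_fg _ this.fg_adjoin_singleton _
        (aeval_mem_adjoin_singleton ℤ z)
    have hlt : ∀ φ : K →+* ℂ, ‖φ (aeval z q)‖ < 1 := by
      intro φ
      have hφ : ‖φ z‖ = 1 := (hz.map_of_injective φ.injective).norm'_eq_one hk.ne'
      have h1 := hH (φ z) hφ
      have h2 : aeval (φ z) H = (φ z - (M : ℂ)) * φ (aeval z q) := by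
        have h3 := congrArg φ hzH
        rw [map_mul, map_sub, map_intCast] at h3
        rw [← h3]
        exact aeval_algHom_apply φ.toIntAlgHom z H
      rw [h2, norm_mul] at h1
      have h3 : N - 1 ≤ ‖φ z - (M : ℂ)‖ := by
        have h4 := norm_sub_norm_le (M : ℂ) (φ z)
        rw [hφ, norm_sub_rev, Complex.norm_intCast, hM] at h4
        linarith [le_abs_self N]
      by_contra! h5
      have hL0 : 0 ≤ L := (norm_nonneg _).trans (hH (φ z) hφ)
      nlinarith
    obtain ⟨n, hn, h1⟩ := NumberField.Embeddings.pow_eq_one_of_norm_le_one K ℂ h0 hint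
      fun φ => (hlt φ).le
    have φ : K →+* ℂ := Classical.arbitrary _
    have h2 := pow_lt_one₀ (norm_nonneg _) (hlt φ) hn.ne'
    rw [← norm_pow, ← map_pow, h1, map_one, norm_one] at h2
    exact lt_irrefl _ h2
  rw [hzH, hγ, mul_zero]

/-- The product of `N ^ d - 1` over `1 ≤ d ≤ j`. -/
def powSubOneProd (N j : ℕ) : ℕ :=
  Nat.rec 1 (fun d c => c * (N ^ (d + 1) - 1)) j

theorem cast_powSubOneProd {N : ℕ} (hN : 1 ≤ N) (j : ℕ) :
    (powSubOneProd N j : ℤ) = ∏ d ∈ Finset.range j, ((N : ℤ) ^ (d + 1) - 1) := by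
  induction j with
  | zero => rfl
  | succ j ih =>
    rw [Finset.prod_range_succ, ← ih]
    change ((powSubOneProd N j * (N ^ (j + 1) - 1) : ℕ) : ℤ) = _
    rw [Nat.cast_mul, Nat.cast_sub (Nat.one_le_pow _ _ hN)]
    push_cast
    rfl

/-- Lets `X ^ k - 1` replace `Φ_k` in the divisibility test, so that `Φ_k` need not be computed; the
extra factor does not vanish at primitive `k`-th roots of unity. -/
theorem X_pow_sub_one_dvd_cyclotomic_mul {k : ℕ} (hk : 0 < k) :
    (X ^ k - 1 : ℤ[X]) ∣ cyclotomic k ℤ * ∏ d ∈ Finset.range (k - 1), (X ^ (d + 1) - 1) := by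
  rw [← prod_cyclotomic_eq_X_pow_sub_one hk, ← Nat.insert_self_properDivisors hk.ne',
    Finset.prod_insert Nat.self_notMem_properDivisors]
  refine mul_dvd_mul_left _ ?_
  have hsub : k.properDivisors ⊆ Finset.Ico 1 k := fun d hd => by
    rw [Nat.mem_properDivisors] at hd
    exact Finset.mem_Ico.2 ⟨Nat.pos_of_dvd_of_pos hd.1 hk, hd.2⟩
  calc ∏ d ∈ k.properDivisors, cyclotomic d ℤ
      ∣ ∏ d ∈ k.properDivisors, (X ^ d - 1 : ℤ[X]) :=
        Finset.prod_dvd_prod_of_dvd _ _ fun d _ => cyclotomic.dvd_X_pow_sub_one d ℤ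
    _ ∣ ∏ d ∈ Finset.Ico 1 k, (X ^ d - 1 : ℤ[X]) := Finset.prod_dvd_prod_of_subset _ _ _ hsub
    _ = _ := by
        rw [Finset.prod_Ico_eq_prod_range]
        simp only [add_comm 1]

/-- An integer that is large in comparison with the data of a multiplicative relation. -/
def evaluationPoint (m n k r s : ℕ) : ℕ :=
  ((m + 1) ^ r + (n + 1) ^ s) * 2 ^ (k - 1) + (m + n + 2)

/-- The congruence deciding whether `(ζ - m) ^ r = (ζ - n) ^ s` for `ζ` of order `k`. -/
def RelationTest (m n k r s : ℕ) : Prop :=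
  ((evaluationPoint m n k r s - m) ^ r * powSubOneProd (evaluationPoint m n k r s) (k - 1)) %
      (evaluationPoint m n k r s ^ k - 1) =
    ((evaluationPoint m n k r s - n) ^ s * powSubOneProd (evaluationPoint m n k r s) (k - 1)) %
      (evaluationPoint m n k r s ^ k - 1)

theorem relationTest_iff_dvd {m n k r s : ℕ} :
    RelationTest m n k r s ↔ ((evaluationPoint m n k r s : ℤ) ^ k - 1) ∣
      (((-(m : ℤ[X]) + X) ^ r - (-(n : ℤ[X]) + X) ^ s) *
        ∏ d ∈ Finset.range (k - 1), (X ^ (d + 1) - 1)).eval (evaluationPoint m n k r s : ℤ) := by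
  rw [RelationTest]
  -- The summand `m + n + 2` keeps the natural subtractions from truncating.
  have hm : m ≤ evaluationPoint m n k r s := by rw [evaluationPoint]; omega
  have hn : n ≤ evaluationPoint m n k r s := by rw [evaluationPoint]; omega
  have h1 : 1 ≤ evaluationPoint m n k r s := by rw [evaluationPoint]; omega
  generalize evaluationPoint m n k r s = N at *
  change _ ≡ _ [MOD _] ↔ _
  rw [Nat.ModEq.comm, Nat.modEq_iff_dvd]
  rw [Nat.cast_sub (Nat.one_le_pow k N h1)]
  push_cast [hm, hn, cast_powSubOneProd h1]
  simp only [eval_mul, eval_sub, eval_pow, eval_natCast, eval_X, eval_prod,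
    eval_one, sub_mul, neg_add_eq_sub]

theorem relationTest_iff {k : ℕ} (hk : 3 ≤ k) {ζ : ℂ} (hζ : IsPrimitiveRoot ζ k)
    (m n r s : ℕ) :
    RelationTest m n k r s ↔ (-(m : ℂ) + ζ) ^ r = (-(n : ℂ) + ζ) ^ s := by
  have : NeZero k := ⟨by omega⟩
  have := isCyclotomicExtension_cyclotomicField_rat k
  have hz := IsCyclotomicExtension.zeta_spec k ℚ (CyclotomicField k ℚ)
  rw [pow_eq_pow_iff (by omega) hζ hz, relationTest_iff_dvd]
  generalize IsCyclotomicExtension.zeta k ℚ (CyclotomicField k ℚ) = z at hz ⊢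
  have hF : aeval z ((-(m : ℤ[X]) + X) ^ r - (-(n : ℤ[X]) + X) ^ s) = 0 ↔
      (-(m : CyclotomicField k ℚ) + z) ^ r = (-(n : CyclotomicField k ℚ) + z) ^ s := by
    simp [sub_eq_zero]
  rw [← hF]
  constructor
  · intro hdvd
    have h0 := aeval_eq_zero_of_dvd_eval (by omega) hz (M := evaluationPoint m n k r s)
      (N := evaluationPoint m n k r s) (L := ((m + 1) ^ r + (n + 1) ^ s) * 2 ^ (k - 1))
      (by simp) ?_ ?_ hdvd
    · rw [map_mul] at h0
      refine (mul_eq_zero.1 h0).resolve_right ?_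
      rw [map_prod, Finset.prod_eq_zero_iff]
      rintro ⟨d, hd, h1⟩
      rw [Finset.mem_range] at hd
      refine hz.pow_ne_one_of_pos_of_lt (l := d + 1) (by omega) (by omega) ?_
      simpa [sub_eq_zero] using h1
    -- On the unit circle `|η - x| ≤ x + 1` and `|η ^ d - 1| ≤ 2`, whence the shape of
    -- `evaluationPoint`.
    · intro η hη
      rw [map_mul, map_prod, norm_mul, norm_prod]
      refine mul_le_mul ?_ ?_ (Finset.prod_nonneg fun _ _ => norm_nonneg _) (by positivity)
      · have hle : ∀ x : ℕ, ‖-(x : ℂ) + η‖ ≤ x + 1 := fun x =>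
          (norm_add_le _ _).trans (by rw [norm_neg, Complex.norm_natCast, hη])
        simp only [map_sub, map_pow, map_add, map_neg, map_natCast, aeval_X]
        refine (norm_sub_le _ _).trans ?_
        rw [norm_pow, norm_pow]
        exact add_le_add (pow_le_pow_left₀ (norm_nonneg _) (hle m) r)
          (pow_le_pow_left₀ (norm_nonneg _) (hle n) s)
      · refine (Finset.prod_le_prod (g := fun _ => (2 : ℝ)) (fun _ _ => norm_nonneg _)
          fun d _ => ?_).trans (by simp)
        simp only [map_sub, map_pow, map_one, aeval_X]
        refine (norm_sub_le _ _).trans ?_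
        rw [norm_pow, hη, one_pow, norm_one]
        norm_num
    · rw [evaluationPoint]
      push_cast
      linarith [m.cast_nonneg (α := ℝ), n.cast_nonneg (α := ℝ)]
  · intro h0
    have h1 := (cyclotomic_dvd_iff_aeval_eq_zero (by omega) hz _).2 h0
    have h2 := (X_pow_sub_one_dvd_cyclotomic_mul (by omega)).trans (mul_dvd_mul_right h1 _)
    simpa using eval_dvd (x := (evaluationPoint m n k r s : ℤ)) h2

/-- The bounded search for a multiplicative relation. -/
def DependenceTest (m n k : ℕ) : Prop :=
  ∃ r ∈ List.range (exponentBound n k + 1), ∃ s ∈ List.range (exponentBound n k + 1),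
    1 ≤ r ∧ RelationTest m n k r s

theorem dependenceTest_iff {k : ℕ} (hk : 3 ≤ k) {ζ : ℂ} (hζ : IsPrimitiveRoot ζ k)
    {m n : ℕ} (hmn : m ≤ n) (hn : 2 ≤ n) :
    DependenceTest m n k ↔ MultDependent (-(m : ℂ) + ζ) (-(n : ℂ) + ζ) := by
  constructor
  · rintro ⟨r, -, s, -, hr, h⟩
    exact multDependent_of_pow_eq hr ((relationTest_iff hk hζ m n r s).1 h)
  · intro h
    obtain ⟨r, s, hr, hrb, hsb, he⟩ := exists_bounded_pow_eq hk hζ hmn hn h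
    exact ⟨r, List.mem_range.2 (by omega), s, List.mem_range.2 (by omega), hr,
      (relationTest_iff hk hζ m n r s).2 he⟩

/-! ### Primitive recursiveness -/

theorem primrec₂_nat_pow : Primrec₂ ((· ^ ·) : ℕ → ℕ → ℕ) :=
  Primrec₂.unpaired'.1 Nat.Primrec.pow

theorem primrec₂_powSubOneProd : Primrec₂ powSubOneProd := by
  refine Primrec.nat_rec (f := fun _ : ℕ => 1)
    (g := fun (N : ℕ) (p : ℕ × ℕ) => p.2 * (N ^ (p.1 + 1) - 1)) (Primrec.const 1) ?_
  have hN : Primrec fun x : ℕ × ℕ × ℕ => x.1 := Primrec.fst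
  have hd : Primrec fun x : ℕ × ℕ × ℕ => x.2.1 := Primrec.fst.comp Primrec.snd
  have hc : Primrec fun x : ℕ × ℕ × ℕ => x.2.2 := Primrec.snd.comp Primrec.snd
  exact Primrec.nat_mul.comp hc (Primrec.nat_sub.comp
    (primrec₂_nat_pow.comp hN (Primrec.succ.comp hd)) (Primrec.const 1))

section

variable {α : Type*} [Primcodable α] {m n k r s : α → ℕ}

theorem primrec_exponentBound (hn : Primrec n) (hk : Primrec k) :
    Primrec fun x => exponentBound (n x) (k x) :=
  Primrec.nat_mul.comp (Primrec.nat_mul.comp (Primrec.const 2) hk)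
    (primrec₂_nat_pow.comp (Primrec.succ.comp hn) hk)

theorem primrec_evaluationPoint (hm : Primrec m) (hn : Primrec n) (hk : Primrec k)
    (hr : Primrec r) (hs : Primrec s) :
    Primrec fun x => evaluationPoint (m x) (n x) (k x) (r x) (s x) :=
  Primrec.nat_add.comp
    (Primrec.nat_mul.comp
      (Primrec.nat_add.comp (primrec₂_nat_pow.comp (Primrec.succ.comp hm) hr)
        (primrec₂_nat_pow.comp (Primrec.succ.comp hn) hs))
      (primrec₂_nat_pow.comp (Primrec.const 2) (Primrec.nat_sub.comp hk (Primrec.const 1))))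
    (Primrec.nat_add.comp (Primrec.nat_add.comp hm hn) (Primrec.const 2))

theorem primrecPred_relationTest (hm : Primrec m) (hn : Primrec n) (hk : Primrec k)
    (hr : Primrec r) (hs : Primrec s) :
    PrimrecPred fun x => RelationTest (m x) (n x) (k x) (r x) (s x) := by
  have hN := primrec_evaluationPoint hm hn hk hr hs
  have hP := primrec₂_powSubOneProd.comp hN (Primrec.nat_sub.comp hk (Primrec.const 1))
  have hQ := Primrec.nat_sub.comp (primrec₂_nat_pow.comp hN hk) (Primrec.const 1)
  have side : ∀ {u e : α → ℕ}, Primrec u → Primrec e → Primrec fun x =>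
      ((evaluationPoint (m x) (n x) (k x) (r x) (s x) - u x) ^ e x *
        powSubOneProd (evaluationPoint (m x) (n x) (k x) (r x) (s x)) (k x - 1)) %
          (evaluationPoint (m x) (n x) (k x) (r x) (s x) ^ k x - 1) := fun hu he =>
    Primrec.nat_mod.comp
      (Primrec.nat_mul.comp (primrec₂_nat_pow.comp (Primrec.nat_sub.comp hN hu) he) hP) hQ
  exact Primrec.eq.comp (side hm hr) (side hn hs)

theorem primrecPred_dependenceTest (hm : Primrec m) (hn : Primrec n) (hk : Primrec k) :
    PrimrecPred fun x => DependenceTest (m x) (n x) (k x) := by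
  have hrange := Primrec.list_range.comp (Primrec.succ.comp (primrec_exponentBound hn hk))
  have inner : PrimrecRel fun (s : ℕ) (y : ℕ × α) =>
      1 ≤ y.1 ∧ RelationTest (m y.2) (n y.2) (k y.2) y.1 s := by
    have hx : Primrec fun w : ℕ × ℕ × α => w.2.2 := Primrec.snd.comp Primrec.snd
    have hr : Primrec fun w : ℕ × ℕ × α => w.2.1 := Primrec.fst.comp Primrec.snd
    exact (PrimrecPred.and (Primrec.nat_le.comp (Primrec.const 1) hr)
      (primrecPred_relationTest (hm.comp hx) (hn.comp hx) (hk.comp hx) hr Primrec.fst)).primrecRel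
  have outer : PrimrecRel fun (r : ℕ) (x : α) =>
      ∃ s ∈ List.range (exponentBound (n x) (k x) + 1),
        1 ≤ r ∧ RelationTest (m x) (n x) (k x) r s :=
    (inner.exists_mem_list.comp (hrange.comp Primrec.snd) Primrec.id).primrecRel
  exact outer.exists_mem_list.comp hrange Primrec.id

end

/-! ### Listing the pairs -/

/-- The decision procedure for membership of the pair coded by `q` in `dependentPairs ζ a`. -/
def PairTest (q a : ℕ) : Prop :=
  (1 ≤ q.unpair.1 ∧ 3 ≤ q.unpair.2) ∧
    DependenceTest q.unpair.1 (q.unpair.1 + a) q.unpair.2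

theorem primrecRel_pairTest : PrimrecRel PairTest := by
  have hq : Primrec fun w : ℕ × ℕ => w.1.unpair := Primrec.unpair.comp Primrec.fst
  have hm := Primrec.fst.comp hq
  have hk := Primrec.snd.comp hq
  exact (PrimrecPred.and (PrimrecPred.and (Primrec.nat_le.comp (Primrec.const 1) hm)
    (Primrec.nat_le.comp (Primrec.const 3) hk))
    (primrecPred_dependenceTest hm (Primrec.nat_add.comp hm Primrec.snd) hk)).primrecRel

theorem pairTest_iff {ζ : ℕ → ℂ} (hζ : ∀ k, 3 ≤ k → IsPrimitiveRoot (ζ k) k) {a : ℕ}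
    (ha : 0 < a) (q : ℕ) : PairTest q a ↔ q.unpair ∈ dependentPairs ζ a := by
  rw [PairTest, dependentPairs, Set.mem_ofPred_eq, ← and_assoc, and_congr_right_iff]
  rintro ⟨hm, hk⟩
  rw [dependenceTest_iff hk (hζ _ hk) (by omega) (by omega), Nat.cast_add]

open Classical in
/-- The list of all pairs in `dependentPairs ζ a`. -/
noncomputable def dependentPairsList (a : ℕ) : List (ℕ × ℕ) :=
  ((List.range ((a + 7) ^ 2)).filter fun q => PairTest q a).map Nat.unpair

theorem primrec_dependentPairsList : Primrec dependentPairsList := by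
  classical
  refine Primrec.list_map ?_ (Primrec.unpair.comp Primrec.snd).to₂
  refine (Primrec.of_eq (primrecRel_pairTest.listFilter.comp (Primrec.list_range.comp
    (primrec₂_nat_pow.comp (Primrec.nat_add.comp Primrec.id (Primrec.const 7)) (Primrec.const 2)))
      Primrec.id) fun a => ?_)
  rfl

theorem mem_dependentPairsList {ζ : ℕ → ℂ} (hζ : ∀ k, 3 ≤ k → IsPrimitiveRoot (ζ k) k) {a : ℕ}
    (ha : 0 < a) (x : ℕ × ℕ) : x ∈ dependentPairsList a ↔ x ∈ dependentPairs ζ a := by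
  simp only [dependentPairsList, List.mem_map, List.mem_filter, List.mem_range,
    decide_eq_true_eq, pairTest_iff hζ ha]
  constructor
  · rintro ⟨q, ⟨-, hq⟩, rfl⟩
    exact hq
  · intro hx
    refine ⟨Nat.pair x.1 x.2, ⟨?_, by simpa using hx⟩, by simp⟩
    obtain ⟨h1, h2⟩ := dependentPairs_bounds hζ ha (m := x.1) (k := x.2) hx
    -- The code of a pair is below `(max + 1) ^ 2`, so the search up to `(a + 7) ^ 2` misses none.
    refine (Nat.pair_lt_max_add_one_sq _ _).trans_le (Nat.pow_le_pow_left ?_ 2)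
    have := max_lt h1 h2
    omega

theorem mainTheorem2 :
    -- finiteness, with the bounds on `k` and on `Φ_k(x)`
    (∀ ζ : ℕ → ℂ, (∀ k, 3 ≤ k → IsPrimitiveRoot (ζ k) k) → ∀ a : ℕ, 0 < a →
      (dependentPairs ζ a).Finite ∧
      ∀ m k : ℕ, (m, k) ∈ dependentPairs ζ a → (m, k) ≠ (1, 6) →
        (cyclotomicPrimes a m k).Nonempty ∧
        (∀ p ∈ cyclotomicPrimes a m k, p ∣ a ∧ ¬ p ∣ k ∧ k ≤ p ^ padicValNat p a) ∧
        (cyclotomicValue k m ∣ (boundingInteger a m k : ℤ) ∨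
          cyclotomicValue k (m + a) ∣ (boundingInteger a m k : ℤ))) ∧
    -- one algorithm lists all the pairs, on input `a`
    (∃ f : ℕ → List (ℕ × ℕ), Computable f ∧
      ∀ ζ : ℕ → ℂ, (∀ k, 3 ≤ k → IsPrimitiveRoot (ζ k) k) → ∀ a : ℕ, 0 < a →
        ∀ x : ℕ × ℕ, x ∈ f a ↔ x ∈ dependentPairs ζ a) := by
  refine ⟨fun ζ hζ a ha => ⟨?_, fun m k hmk hne => ?_⟩, dependentPairsList,
    primrec_dependentPairsList.to_comp, fun ζ hζ a ha x => mem_dependentPairsList hζ ha x⟩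
  · refine (List.finite_toSet (dependentPairsList a)).subset fun x hx => ?_
    exact (mem_dependentPairsList hζ ha x).2 hx
  · obtain ⟨hm, hk, hd⟩ := hmk
    simp only at hm hk hd
    obtain ⟨hA, hne', hS⟩ := dependent_bounds hk (hζ k hk) hm ha
      (by simpa [Prod.ext_iff] using hne) (by exact_mod_cast hd)
    -- The alternative `x = m` always holds.
    refine ⟨hne', fun p hp => ?_, Or.inl (dvd_boundingInteger hk ha hA hS)⟩
    obtain ⟨hpa, hpk, hkp⟩ := hS p hp
    have hpp := Nat.prime_of_mem_primeFactors hp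
    have := Fact.mk hpp
    refine ⟨hpa, hpk, ?_⟩
    calc k ≤ p := (Nat.le_of_dvd (by have := hpp.one_lt; omega) hkp).trans (Nat.sub_le _ _)
      _ = p ^ 1 := (pow_one p).symm
      _ ≤ _ := Nat.pow_le_pow_right hpp.pos (one_le_padicValNat_of_dvd ha.ne' hpa)
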